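/- Let $n \in \mathbb{N}$ and let $K$ be a field in which every polynomial of degree exactly $n$ over $K$ has a root. Let $M_n(K)$ denote the space of $n \times n$ matrices over $K$, and let $T : M_n(K) \to M_n(K)$ be a $K$-linear map which preserves invertibility, that is, $T(A)$ is invertible for every invertible $A \in M_n(K)$. Then $T$ is bijective, and $T$ preserves singularity, that is, $T(A)$ is singular for every singular $A \in M_n(K)$. -/

import Mathlib

/-! For singular A some C makes xA - C invertible for every x, hence also xT(A) - T(C). Were T(A)
invertible, a root x of the characteristic polynomial of T(A)⁻¹T(C) would contradict this. So T
preserves singularity. If T(A) = 0 with A ≠ 0, take S singular with S + A invertible: T(S) = T(S +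
A) is both singular and invertible. Finite dimension gives surjectivity. -/

open Matrix in
/-- Every square matrix over a field is equivalent to a diagonal one. -/
theorem Matrix.exists_isUnit_mul_diagonal_mul {K : Type*} [Field K] {n : ℕ}
    (A : Matrix (Fin n) (Fin n) K) :
    ∃ (P Q : Matrix (Fin n) (Fin n) K) (d : Fin n → K),
      IsUnit P ∧ IsUnit Q ∧ A = P * diagonal d * Q := by
  obtain ⟨L, L', d, h⟩ := Pivot.exists_list_transvec_mul_diagonal_mul_list_transvec A
  refine ⟨_, _, d, ?_, ?_, h⟩ <;>
    simp [Matrix.isUnit_iff_isUnit_det, TransvectionStruct.det_toMatrix_prod]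

open Matrix Fin.CommRing in
/-- A singular diagonal matrix generates, together with a cyclic permutation matrix, a pencil
all of whose members are invertible. -/
theorem Matrix.exists_forall_isUnit_smul_diagonal_sub {K : Type*} [Field K] {n : ℕ}
    (d : Fin n → K) (i₀ : Fin n) (h₀ : d i₀ = 0) :
    ∃ C : Matrix (Fin n) (Fin n) K, ∀ x : K, IsUnit (x • diagonal d - C) := by
  have : NeZero n := ⟨by rintro rfl; exact i₀.elim0⟩
  refine ⟨Matrix.of fun i j => if j = i + 1 then 1 else 0, fun x => ?_⟩
  rw [← Matrix.mulVec_injective_iff_isUnit]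
  refine (injective_iff_map_eq_zero (Matrix.mulVecLin _)).2 fun v hv => ?_
  have key : ∀ i, v (i + 1) = x * (d i * v i) := fun i => by
    have := congrFun hv i
    simp only [mulVecLin_apply, sub_mulVec, smul_mulVec, Pi.sub_apply, Pi.smul_apply,
      mulVec_diagonal, smul_eq_mul, Pi.zero_apply, sub_eq_zero] at this
    rw [this]
    simp [mulVec, dotProduct]
  -- Since `d i₀ = 0`, a kernel vector vanishes at `i₀ + 1`; `key` carries the zero around the whole
  -- cycle.
  have step : ∀ k : ℕ, v (i₀ + 1 + (k : Fin n)) = 0 := fun k => by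
    induction k with
    | zero => simp [key, h₀]
    | succ k ih => rw [Nat.cast_succ, ← add_assoc, key, ih]; simp
  ext j
  simpa using step (j - (i₀ + 1) : Fin n).val

open Matrix in
/-- A singular matrix lies in the direction of an affine line of invertible matrices. -/
theorem Matrix.exists_forall_isUnit_smul_sub {K : Type*} [Field K] {n : ℕ}
    {A : Matrix (Fin n) (Fin n) K} (hA : ¬ IsUnit A) :
    ∃ C : Matrix (Fin n) (Fin n) K, ∀ x : K, IsUnit (x • A - C) := by
  obtain ⟨P, Q, d, hP, hQ, rfl⟩ := A.exists_isUnit_mul_diagonal_mul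
  have hd : ¬ ∀ i, d i ≠ 0 := fun h => hA <| by
    refine (hP.mul ?_).mul hQ
    rw [Matrix.isUnit_iff_isUnit_det, det_diagonal, isUnit_iff_ne_zero]
    exact Finset.prod_ne_zero_iff.2 fun i _ => h i
  push Not at hd
  obtain ⟨i, hi⟩ := hd
  obtain ⟨C, hC⟩ := exists_forall_isUnit_smul_diagonal_sub d i hi
  refine ⟨P * C * Q, fun x => ?_⟩
  have : x • (P * diagonal d * Q) - P * C * Q = P * (x • diagonal d - C) * Q := by
    simp [mul_sub, sub_mul]
  rw [this]
  exact (hP.mul (hC x)).mul hQ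

open Matrix in
/-- Every nonzero matrix is the difference of an invertible matrix and a singular one. -/
theorem Matrix.exists_not_isUnit_isUnit_add {K : Type*} [Field K] {n : ℕ}
    {A : Matrix (Fin n) (Fin n) K} (hA : A ≠ 0) :
    ∃ S : Matrix (Fin n) (Fin n) K, ¬ IsUnit S ∧ IsUnit (S + A) := by
  obtain ⟨P, Q, d, hP, hQ, rfl⟩ := A.exists_isUnit_mul_diagonal_mul
  obtain ⟨i, hi⟩ : ∃ i, d i ≠ 0 := by
    by_contra! h
    exact hA (by simp [show d = 0 from funext h])
  -- Adding `diagonal d` leaves `d i ≠ 0` at `i` and `1` elsewhere.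
  refine ⟨P * diagonal (fun j => if j = i then 0 else 1 - d j) * Q, ?_, ?_⟩
  · rw [Matrix.isUnit_iff_isUnit_det, isUnit_iff_ne_zero, not_not, det_mul, det_mul, det_diagonal,
      Finset.prod_eq_zero (Finset.mem_univ i) (by simp)]
    simp
  · rw [← add_mul, ← mul_add, diagonal_add]
    refine (hP.mul ?_).mul hQ
    rw [Matrix.isUnit_iff_isUnit_det, det_diagonal, isUnit_iff_ne_zero]
    refine Finset.prod_ne_zero_iff.2 fun j _ => ?_
    by_cases hj : j = i
    · simpa [hj] using hi
    · simp [hj]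

/-- If polynomials of degree `n` have roots, every affine line of `n × n` matrices with invertible
direction meets the singular matrices. -/
theorem Matrix.exists_not_isUnit_smul_sub {K : Type*} [Field K] {n : ℕ}
    (hK : ∀ p : Polynomial K, p.degree = (n : WithBot ℕ) → ∃ x : K, p.IsRoot x)
    {B : Matrix (Fin n) (Fin n) K} (hB : IsUnit B) (C : Matrix (Fin n) (Fin n) K) :
    ∃ x : K, ¬ IsUnit (x • B - C) := by
  obtain ⟨U, rfl⟩ := hB
  obtain ⟨x, hx⟩ := hK (((U⁻¹ : (Matrix (Fin n) (Fin n) K)ˣ) : Matrix (Fin n) (Fin n) K) * C).charpoly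
    (by simp [Matrix.charpoly_degree_eq_dim])
  refine ⟨x, fun h => ?_⟩
  have h' := U⁻¹.isUnit.mul h
  rw [mul_sub, mul_smul_comm, Units.inv_mul, Matrix.isUnit_iff_isUnit_det, isUnit_iff_ne_zero] at h'
  apply h'
  rwa [Polynomial.IsRoot, Matrix.eval_charpoly, Matrix.scalar_apply, ← Matrix.smul_one_eq_diagonal]
    at hx

theorem mainTheorem9 {K : Type*} [Field K] (n : ℕ)
    (hK : ∀ p : Polynomial K, p.degree = (n : WithBot ℕ) → ∃ x : K, p.IsRoot x)
    (T : Matrix (Fin n) (Fin n) K →ₗ[K] Matrix (Fin n) (Fin n) K)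
    (hT : ∀ A : Matrix (Fin n) (Fin n) K, IsUnit A → IsUnit (T A)) :
    Function.Bijective T ∧
      ∀ A : Matrix (Fin n) (Fin n) K, ¬ IsUnit A → ¬ IsUnit (T A) := by
  have hS : ∀ A : Matrix (Fin n) (Fin n) K, ¬ IsUnit A → ¬ IsUnit (T A) := fun A hA hTA => by
    obtain ⟨C, hC⟩ := Matrix.exists_forall_isUnit_smul_sub hA
    obtain ⟨x, hx⟩ := Matrix.exists_not_isUnit_smul_sub hK hTA (T C)
    exact hx (by simpa using hT _ (hC x))
  have hinj : Function.Injective T := (injective_iff_map_eq_zero T).2 fun A hA => by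
    by_contra h
    obtain ⟨S, hS₁, hS₂⟩ := Matrix.exists_not_isUnit_isUnit_add h
    exact hS S hS₁ (by simpa [hA] using hT _ hS₂)
  exact ⟨⟨hinj, LinearMap.injective_iff_surjective.1 hinj⟩, hS⟩
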